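/- Let $u,v\ge 1$ be integers. For a positive rational $z$, let $\mathcal T^{(u,v)}(z)$ be the infinite binary tree with root labelled $z$ in which a vertex labelled $a/b$ has a left child labelled $\frac{a}{ua+b}$ and a right child labelled $\frac{a+vb}{b}$. Let $\mathcal T^{(u,v)}(z;n)$ be the set of its $2^n$ vertices of depth $n$ (the root has depth $0$), identified with their labels, which are pairwise distinct, and let $$A^{(u,v)}(z;n)=\frac1{2^n}\sum_{y\in\mathcal T^{(u,v)}(z;n)}y .$$ Then for all $z_1,z_2\in[1/u,v]\cap\mathbb Q$, $$A^{(u,v)}(z_1;n)-A^{(u,v)}(z_2;n)\to 0\quad\text{as } n\to\infty .$$ Moreover, the limit $\lim_{n\to\infty}A^{(u,v)}(z;n)$ exists in $\mathbb R$ for every $z\in[1/u,v]\cap\mathbb Q$ and does not depend on $z$. -/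

import Mathlib

open Filter Topology

namespace CalkinWilf

/-- The label of the left child of a vertex labelled `q` in a `(u,v)`-Calkin-Wilf tree.
For `q = a / b` this is `a / (u * a + b)`, see `leftChild_div`. -/
def leftChild (u : ℕ) (q : ℚ) : ℚ := q / (u * q + 1)

/-- The label of the right child of a vertex labelled `q` in a `(u,v)`-Calkin-Wilf tree.
For `q = a / b` this is `(a + v * b) / b`, see `rightChild_div`. -/
def rightChild (v : ℕ) (q : ℚ) : ℚ := q + v

theorem leftChild_div (u : ℕ) (a b : ℚ) (hb : b ≠ 0) :
    leftChild u (a / b) = a / (u * a + b) := by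
  have h : (u : ℚ) * (a / b) + 1 = (u * a + b) / b := by field_simp
  rw [leftChild, h, div_div_div_cancel_right₀ hb]

theorem rightChild_div (v : ℕ) (a b : ℚ) (hb : b ≠ 0) :
    rightChild v (a / b) = (a + v * b) / b := by
  rw [rightChild]
  field_simp

/-- The row of depth `n` of the `(u,v)`-Calkin-Wilf tree with root `z`, as the multiset of the
labels of its `2 ^ n` vertices. For positive `u`, `v`, `z` the labels are pairwise distinct
(`row_nodup`), so that this is the set of the labels of depth `n`. -/
def row (u v : ℕ) (z : ℚ) : ℕ → Multiset ℚ
  | 0 => {z}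
  | n + 1 => (row u v z n).map (leftChild u) + (row u v z n).map (rightChild v)

/-- The sum of the labels of depth `n` in the `(u,v)`-Calkin-Wilf tree with root `z`. -/
def rowSum (u v : ℕ) (z : ℚ) (n : ℕ) : ℚ := (row u v z n).sum

/-- The mean of the labels of depth `n` in the `(u,v)`-Calkin-Wilf tree with root `z`. -/
def rowMean (u v : ℕ) (z : ℚ) (n : ℕ) : ℚ := rowSum u v z n / 2 ^ n

theorem row_card (u v : ℕ) (z : ℚ) (n : ℕ) : (row u v z n).card = 2 ^ n := by
  induction n with
  | zero => simp [row]
  | succ n ih => simp [row, ih, pow_succ, mul_two]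

theorem row_pos (u v : ℕ) {z : ℚ} (hz : 0 < z) (n : ℕ) : ∀ q ∈ row u v z n, 0 < q := by
  induction n with
  | zero => simpa [row] using hz
  | succ n ih =>
    intro q hq
    rcases Multiset.mem_add.1 hq with h | h
    · obtain ⟨p, hp, rfl⟩ := Multiset.mem_map.1 h
      have := ih p hp
      unfold leftChild
      positivity
    · obtain ⟨p, hp, rfl⟩ := Multiset.mem_map.1 h
      have := ih p hp
      unfold rightChild
      positivity

theorem row_nodup {u v : ℕ} (hu : 0 < u) (hv : 0 < v) {z : ℚ} (hz : 0 < z) (n : ℕ) :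
    (row u v z n).Nodup := by
  have hu' : (1 : ℚ) ≤ u := by exact_mod_cast hu
  have hv' : (1 : ℚ) ≤ v := by exact_mod_cast hv
  induction n with
  | zero => simp [row]
  | succ n ih =>
    have hpos := row_pos u v hz n
    refine Multiset.nodup_add.2 ⟨?_, ?_, ?_⟩
    · refine Multiset.Nodup.map_on ?_ ih
      intro x hx y hy h
      have hx := hpos x hx
      have hy := hpos y hy
      unfold leftChild at h
      rw [div_eq_div_iff (by positivity) (by positivity)] at h
      linarith
    · refine Multiset.Nodup.map_on ?_ ih
      intro x _ y _ h
      unfold rightChild at h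
      linarith
    · rw [Multiset.disjoint_left]
      intro q h1 h2
      obtain ⟨x, hx, rfl⟩ := Multiset.mem_map.1 h1
      obtain ⟨y, hy, h⟩ := Multiset.mem_map.1 h2
      have hx := hpos x hx
      have hy := hpos y hy
      have : leftChild u x < 1 := by
        unfold leftChild
        rw [div_lt_one (by positivity)]
        nlinarith
      unfold rightChild at h
      linarith

end CalkinWilf

/-!
Depth `n` of the tree lists the images of the root under the `2 ^ n` words of length `n` in the
two maps `leftChild u` and `rightChild v`. Splitting a word at its innermost letter instead of its
outermost one gives the recursion `rowMean_succ`: the mean at depth `n + 1` from `z` is the average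
of the means at depth `n` from the two children of `z`.

On the positive rationals both maps are `1`-Lipschitz, and a right step followed by a left step
contracts distances by a factor `1 / 4`, because the right step leads to a point `≥ v ≥ 1`, where
`leftChild u` has derivative at most `1 / (u * v + 1) ^ 2`. So among the four words of length two
the average Lipschitz constant is at most `(1 + 1 + 1 + 1 / 4) / 4 = 13 / 16`, and the mean at
depth `n` is Lipschitz in the root with a constant that decays geometrically in `n`
(`abs_rowMean_sub_le`). This gives the convergence of differences. The recursion also bounds the
difference of the means at depths `n + 1` and `n` from the same root by the distances of the root to
its children times that constant, so that the means form a Cauchy sequence.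
-/

namespace CalkinWilf

/-- The tree below `z` at depth `n + 1` consists of the trees below the two children at depth `n`,
whereas the definition of `row` lists the children of the vertices of depth `n`. -/
theorem row_succ_eq_add_row_children (u v : ℕ) (z : ℚ) (n : ℕ) :
    row u v z (n + 1) = row u v (leftChild u z) n + row u v (rightChild v z) n := by
  induction n with
  | zero => simp [row]
  | succ n ih =>
    rw [row, ih, row, row, Multiset.map_add, Multiset.map_add]
    exact add_add_add_comm _ _ _ _

theorem rowMean_zero (u v : ℕ) (z : ℚ) : rowMean u v z 0 = z := by
  simp [rowMean, rowSum, row]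

theorem rowMean_succ (u v : ℕ) (z : ℚ) (n : ℕ) :
    rowMean u v z (n + 1)
      = (rowMean u v (leftChild u z) n + rowMean u v (rightChild v z) n) / 2 := by
  simp only [rowMean, rowSum, row_succ_eq_add_row_children, Multiset.sum_add, pow_succ]
  field_simp

theorem leftChild_pos (u : ℕ) {x : ℚ} (hx : 0 < x) : 0 < leftChild u x := by
  unfold leftChild
  positivity

theorem rightChild_pos (v : ℕ) {x : ℚ} (hx : 0 < x) : 0 < rightChild v x := by
  unfold rightChild
  positivity

theorem abs_rightChild_sub (v : ℕ) (x y : ℚ) :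
    |rightChild v x - rightChild v y| = |x - y| := by
  simp [rightChild]

theorem abs_leftChild_sub (u : ℕ) {x y : ℚ} (hx : 0 < x) (hy : 0 < y) :
    |leftChild u x - leftChild u y| = |x - y| / ((u * x + 1) * (u * y + 1)) := by
  have h : leftChild u x - leftChild u y = (x - y) / ((u * x + 1) * (u * y + 1)) := by
    unfold leftChild
    have : (u : ℚ) * x + 1 ≠ 0 := by positivity
    have : (u : ℚ) * y + 1 ≠ 0 := by positivity
    field_simp
    ring
  rw [h, abs_div, abs_of_pos (by positivity : 0 < ((u : ℚ) * x + 1) * (u * y + 1))]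

theorem abs_leftChild_sub_le (u : ℕ) {x y : ℚ} (hx : 0 < x) (hy : 0 < y) :
    |leftChild u x - leftChild u y| ≤ |x - y| := by
  rw [abs_leftChild_sub u hx hy]
  refine div_le_self (abs_nonneg _) (one_le_mul_of_one_le_of_one_le ?_ ?_)
  · exact le_add_of_nonneg_left (by positivity)
  · exact le_add_of_nonneg_left (by positivity)

theorem abs_leftChild_rightChild_sub_le {u v : ℕ} (hu : 0 < u) (hv : 0 < v) {x y : ℚ}
    (hx : 0 < x) (hy : 0 < y) :
    |leftChild u (rightChild v x) - leftChild u (rightChild v y)| ≤ |x - y| / 4 := by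
  have two_le {t : ℚ} (ht : 0 < t) : 2 ≤ (u : ℚ) * rightChild v t + 1 := by
    have hu' : (1 : ℚ) ≤ u := by exact_mod_cast hu
    have hv' : (1 : ℚ) ≤ v := by exact_mod_cast hv
    have : (1 : ℚ) ≤ u * rightChild v t :=
      one_le_mul_of_one_le_of_one_le hu' (by unfold rightChild; linarith)
    linarith
  rw [abs_leftChild_sub u (rightChild_pos v hx) (rightChild_pos v hy), abs_rightChild_sub]
  refine div_le_div_of_nonneg_left (abs_nonneg _) (by norm_num) ?_
  calc (4 : ℚ) = 2 * 2 := by norm_num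
    _ ≤ _ := mul_le_mul (two_le hx) (two_le hy) (by norm_num) (by linarith [two_le hx])

theorem abs_rowMean_succ_sub_le (u v : ℕ) (x y : ℚ) (n : ℕ) :
    |rowMean u v x (n + 1) - rowMean u v y (n + 1)|
      ≤ (|rowMean u v (leftChild u x) n - rowMean u v (leftChild u y) n|
        + |rowMean u v (rightChild v x) n - rowMean u v (rightChild v y) n|) / 2 := by
  rw [rowMean_succ, rowMean_succ, ← sub_div, add_sub_add_comm, abs_div, abs_two]
  gcongr
  exact abs_add_le _ _

/-- The mean at depth `n` is Lipschitz in the root, with a geometrically decaying constant. -/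
theorem abs_rowMean_sub_le {u v : ℕ} (hu : 0 < u) (hv : 0 < v) (n : ℕ) {x y : ℚ}
    (hx : 0 < x) (hy : 0 < y) :
    |rowMean u v x n - rowMean u v y n| ≤ 2 * (19 / 20) ^ n * |x - y| := by
  induction n using Nat.twoStepInduction generalizing x y with
  | zero =>
    rw [rowMean_zero, rowMean_zero]
    linarith [abs_nonneg (x - y)]
  | one =>
    have h := abs_rowMean_succ_sub_le u v x y 0
    simp only [rowMean_zero, abs_rightChild_sub] at h
    linarith [abs_leftChild_sub_le u hx hy, abs_nonneg (x - y)]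
  | more n ih _ =>
    have hLx := leftChild_pos u hx
    have hLy := leftChild_pos u hy
    have hRx := rightChild_pos v hx
    have hRy := rightChild_pos v hy
    have hK : (0 : ℚ) ≤ 2 * (19 / 20) ^ n := by positivity
    have hL := abs_leftChild_sub_le u hx hy
    have hLL := (ih (leftChild_pos u hLx) (leftChild_pos u hLy)).trans
      (mul_le_mul_of_nonneg_left ((abs_leftChild_sub_le u hLx hLy).trans hL) hK)
    have hLR := (ih (rightChild_pos v hLx) (rightChild_pos v hLy)).trans
      (mul_le_mul_of_nonneg_left ((abs_rightChild_sub v _ _).trans_le hL) hK)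
    have hRL := (ih (leftChild_pos u hRx) (leftChild_pos u hRy)).trans
      (mul_le_mul_of_nonneg_left (abs_leftChild_rightChild_sub_le hu hv hx hy) hK)
    have hRR := (ih (rightChild_pos v hRx) (rightChild_pos v hRy)).trans
      (mul_le_mul_of_nonneg_left
        ((abs_rightChild_sub v _ _).trans (abs_rightChild_sub v x y)).le hK)
    have h := abs_rowMean_succ_sub_le u v x y (n + 1)
    have h1 := abs_rowMean_succ_sub_le u v (leftChild u x) (leftChild u y) n
    have h2 := abs_rowMean_succ_sub_le u v (rightChild v x) (rightChild v y) n
    have hpos : 0 ≤ 2 * (19 / 20) ^ n * |x - y| := by positivity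
    -- The rate `19 / 20` is chosen so that its square exceeds the two-step constant `13 / 16`.
    calc _ ≤ 13 / 16 * (2 * (19 / 20) ^ n * |x - y|) := by linarith
      _ ≤ (19 / 20) ^ 2 * (2 * (19 / 20) ^ n * |x - y|) := by gcongr; norm_num
      _ = _ := by ring

/-- The means at consecutive depths differ by a geometrically small amount, since the mean at
depth `n + 1` is the average of two means at depth `n` from nearby roots. -/
theorem abs_rowMean_sub_rowMean_succ_le {u v : ℕ} (hu : 0 < u) (hv : 0 < v) (n : ℕ) {z : ℚ}
    (hz : 0 < z) :
    |rowMean u v z n - rowMean u v z (n + 1)|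
      ≤ (|z - leftChild u z| + |z - rightChild v z|) * (19 / 20) ^ n := by
  have h1 := abs_rowMean_sub_le hu hv n hz (leftChild_pos u hz)
  have h2 := abs_rowMean_sub_le hu hv n hz (rightChild_pos v hz)
  have h : rowMean u v z n - rowMean u v z (n + 1)
      = ((rowMean u v z n - rowMean u v (leftChild u z) n)
        + (rowMean u v z n - rowMean u v (rightChild v z) n)) / 2 := by
    rw [rowMean_succ]
    ring
  rw [h, abs_div, abs_two]
  linarith [abs_add_le (rowMean u v z n - rowMean u v (leftChild u z) n)
    (rowMean u v z n - rowMean u v (rightChild v z) n)]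

theorem tendsto_rowMean_sub {u v : ℕ} (hu : 0 < u) (hv : 0 < v) {x y : ℚ} (hx : 0 < x)
    (hy : 0 < y) :
    Tendsto (fun n : ℕ => ((rowMean u v x n : ℚ) : ℝ) - ((rowMean u v y n : ℚ) : ℝ))
      atTop (𝓝 0) := by
  have hgeom : Tendsto (fun n : ℕ => 2 * (19 / 20 : ℝ) ^ n * |(x : ℝ) - y|) atTop (𝓝 0) := by
    simpa using ((tendsto_pow_atTop_nhds_zero_of_lt_one (r := (19 / 20 : ℝ)) (by norm_num)
      (by norm_num)).const_mul 2).mul_const |(x : ℝ) - y|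
  refine squeeze_zero_norm (fun n => ?_) hgeom
  rw [Real.norm_eq_abs]
  have h : ((|rowMean u v x n - rowMean u v y n| : ℚ) : ℝ)
      ≤ ((2 * (19 / 20) ^ n * |x - y| : ℚ) : ℝ) :=
    Rat.cast_le.2 (abs_rowMean_sub_le hu hv n hx hy)
  push_cast at h
  exact h

theorem exists_tendsto_rowMean {u v : ℕ} (hu : 0 < u) (hv : 0 < v) {z : ℚ} (hz : 0 < z) :
    ∃ L : ℝ, Tendsto (fun n : ℕ => ((rowMean u v z n : ℚ) : ℝ)) atTop (𝓝 L) := by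
  refine cauchySeq_tendsto_of_complete (cauchySeq_of_le_geometric (19 / 20 : ℝ)
    ((|z - leftChild u z| + |z - rightChild v z| : ℚ) : ℝ) (by norm_num) fun n => ?_)
  rw [Real.dist_eq]
  have h : ((|rowMean u v z n - rowMean u v z (n + 1)| : ℚ) : ℝ)
      ≤ (((|z - leftChild u z| + |z - rightChild v z|) * (19 / 20) ^ n : ℚ) : ℝ) :=
    Rat.cast_le.2 (abs_rowMean_sub_rowMean_succ_le hu hv n hz)
  push_cast at h ⊢
  exact h

end CalkinWilf

theorem proposition2p9 (u v : ℕ) (hu : 0 < u) (hv : 0 < v) :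
    (∀ z₁ ∈ Set.Icc (1 / (u : ℚ)) (v : ℚ), ∀ z₂ ∈ Set.Icc (1 / (u : ℚ)) (v : ℚ),
      Tendsto
        (fun n : ℕ =>
          ((CalkinWilf.rowMean u v z₁ n : ℚ) : ℝ) - ((CalkinWilf.rowMean u v z₂ n : ℚ) : ℝ))
        atTop (𝓝 0)) ∧
    ∃ L : ℝ, ∀ z ∈ Set.Icc (1 / (u : ℚ)) (v : ℚ),
      Tendsto (fun n : ℕ => ((CalkinWilf.rowMean u v z n : ℚ) : ℝ)) atTop (𝓝 L) := by
  have pos {z : ℚ} (hz : z ∈ Set.Icc (1 / (u : ℚ)) (v : ℚ)) : 0 < z :=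
    lt_of_lt_of_le (by positivity) hz.1
  refine ⟨fun z₁ h₁ z₂ h₂ => CalkinWilf.tendsto_rowMean_sub hu hv (pos h₁) (pos h₂), ?_⟩
  obtain ⟨L, hL⟩ := CalkinWilf.exists_tendsto_rowMean hu hv one_pos
  exact ⟨L, fun z hz => by
    simpa using (CalkinWilf.tendsto_rowMean_sub hu hv (pos hz) one_pos).add hL⟩
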